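/- Write $(x,y)$ with $x,y\in\{0,1\}^{\mathbb Z}$ for a microstate of the Kac infinite chain ($2x(i)-1$ is the spin and $y(i)$ the scatterer occupation at site $i$). The dynamics $\varphi$ on $\{0,1\}^{\mathbb Z}\times\{0,1\}^{\mathbb Z}$ is \[\varphi(x,y)(i)=\bigl(x(i-1)+y(i-1)-2x(i-1)y(i-1),\ y(i)\bigr),\] the macroscopic variables are \[m_0^N(x,y)=\frac1{2N+1}\sum_{i=-N}^{N}(2x(i)-1),\qquad m_1^N(x,y)=\frac1{2N+1}\sum_{i=-N}^{N}y(i),\] and the macroscopic law is $\Phi(m_0,m_1)=((1-2m_1)m_0,\,m_1)$. For $p\in[0,1]$ let $\mu_p$ be the Bernoulli measure on $\{0,1\}^{\mathbb Z}$ (independent sites, each equal to $1$ with probability $p$), and put $\mu_m=\mu_{(1+m_0)/2}\times\mu_{m_1}$. A real $r$ is computable if $\{q\in\mathbb Q:q<r\}$ and $\{q\in\mathbb Q:q<-r\}$ are computably enumerable. A Martin-Löf test for a computable probability measure $\nu$ on $\{0,1\}^{\mathbb N}$ is a sequence $U_n=\bigcup_{\sigma\in S_n}[\sigma]$, where $[\sigma]$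 is the set of infinite sequences with prefix $\sigma$ and $(S_n)_{n\in\mathbb N}$ is a sequence of sets of finite binary strings that is computably enumerable uniformly in $n$, such that $\nu(U_n)\le 2^{-n}$ for all $n\in\mathbb N$; $z\in\{0,1\}^{\mathbb N}$ is Martin-Löf random with respect to $\nu$ if $z\notin\bigcap_n U_n$ for every such test. A microstate $(x,y)$ is Martin-Löf random with respect to $\mu_m$ if its code $\kappa(\iota(x),\iota(y))$ is Martin-Löf random with respect to the image of $\mu_m$ under $(x,y)\mapsto\kappa(\iota(x),\iota(y))$, where $\iota(x)=x(0)x(-1)x(1)x(-2)x(2)\dots$ and $\kappa(u,v)=u(0)v(0)u(1)v(1)\dots$. Theorem. Let $m=(m_0,m_1)\in[-1,1]\times[0,1]$ with $m_0$ and $m_1$ computable reals, and let $T\in\mathbb N$. If $(x,y)\in\{0,1\}^{\mathbb Z}\times\{0,1\}^{\mathbb Z}$ is Martin-Löf random with respect to $\mu_m$, then \[\lim_{N\to\infty}m_i^N(\varphi^t(x,y))=\Phi_i^t(m)\qquad\text{for all } i\in\{0,1\}\text{ and } t\in\{0,\dots,T\},\] where $\Phi_i^t(m)$ is the $i$-th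 component of $\Phi^t(m)$. -/

import Mathlib

open MeasureTheory ProbabilityTheory Filter Topology
open scoped ENNReal

noncomputable section

namespace KacChain

/-! ### Computability -/

/-- A set `A` of finite objects is computably enumerable if it is the range of a partial
computable function defined on (a subset of) the finite binary strings. -/
def IsCE {α : Type} [Primcodable α] (A : Set α) : Prop :=
  ∃ f : List Bool →. α, Partrec f ∧ A = {a | ∃ σ, a ∈ f σ}

/-- A sequence of sets of finite binary strings is computably enumerable uniformly in `n`. -/
def UniformlyCE (A : ℕ → Set (List Bool)) : Prop :=
  ∃ f : List Bool × ℕ →. List Bool, Partrec f ∧ ∀ n, A n = {τ | ∃ σ, τ ∈ f (σ, n)}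

/-- The rational number `(-1)^δ * p / (q + 1)` coded by `(δ, p, q)`. Every rational has such
a code. -/
def ratOfCode (c : Bool × ℕ × ℕ) : ℚ :=
  (if c.1 then -1 else 1) * (c.2.1 : ℚ) / ((c.2.2 : ℚ) + 1)

/-- The set of rationals below `x` is computably enumerable. -/
def LowerSemicomputable (x : ℝ) : Prop :=
  IsCE {c : Bool × ℕ × ℕ | (ratOfCode c : ℝ) < x}

/-- `x` is a computable real: both `x` and `-x` are lower semicomputable. -/
def IsComputableReal (x : ℝ) : Prop :=
  LowerSemicomputable x ∧ LowerSemicomputable (-x)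

/-! ### Martin-Löf randomness on the Cantor space -/

/-- The cylinder set `[σ]` of all infinite binary sequences with prefix `σ`. -/
def cylinder (σ : List Bool) : Set (ℕ → Bool) :=
  {x | ∀ i, ∀ h : i < σ.length, x i = σ[i]}

/-- The sequence `U` of subsets of the Cantor space is c.e. open uniformly in `n`. -/
def UniformlyCEOpen (U : ℕ → Set (ℕ → Bool)) : Prop :=
  ∃ S : ℕ → Set (List Bool), UniformlyCE S ∧ ∀ n, U n = ⋃ σ ∈ S n, cylinder σ

/-- Martin-Löf tests with respect to `μ`. -/
def IsMLTest (μ : Measure (ℕ → Bool)) (U : ℕ → Set (ℕ → Bool)) : Prop :=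
  UniformlyCEOpen U ∧ ∀ n, μ (U n) ≤ (2 : ℝ≥0∞)⁻¹ ^ n

/-- Martin-Löf null sets with respect to `μ`. -/
def IsMLNull (μ : Measure (ℕ → Bool)) (A : Set (ℕ → Bool)) : Prop :=
  ∃ U, IsMLTest μ U ∧ A ⊆ ⋂ n, U n

/-- `x` is Martin-Löf random with respect to `μ`. -/
def IsMLRandom (μ : Measure (ℕ → Bool)) (x : ℕ → Bool) : Prop :=
  ¬ IsMLNull μ {x}

/-! ### Microstates and their coding -/

/-- Microstates `(x, y)`, with `x, y : ℤ → {0, 1}`; `true` stands for `1`, `false` for `0`. -/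
abbrev State : Type := (ℤ → Bool) × (ℤ → Bool)

/-- The enumeration `0, -1, 1, -2, 2, …` of the integers. -/
def site (n : ℕ) : ℤ :=
  if n % 2 = 0 then ((n / 2 : ℕ) : ℤ) else -(((n + 1) / 2 : ℕ) : ℤ)

/-- `iota x = x(0) x(-1) x(1) x(-2) x(2) …`. -/
def iota (x : ℤ → Bool) : ℕ → Bool := fun n => x (site n)

/-- `kappa x y = x(0) y(0) x(1) y(1) …`. -/
def kappa (x y : ℕ → Bool) : ℕ → Bool :=
  fun n => if n % 2 = 0 then x (n / 2) else y (n / 2)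

/-- The coding of microstates by one-sided infinite binary sequences. -/
def encode (s : State) : ℕ → Bool := kappa (iota s.1) (iota s.2)

theorem measurable_encode : Measurable encode := by
  refine measurable_pi_lambda _ fun n => ?_
  unfold encode kappa iota
  split_ifs
  · exact (measurable_pi_apply _).comp measurable_fst
  · exact (measurable_pi_apply _).comp measurable_snd

/-- Martin-Löf randomness of a microstate with respect to a measure on the space of
microstates: its code is random with respect to the image measure. -/
def IsMLRandomState (μ : Measure State) (s : State) : Prop :=
  IsMLRandom (μ.map encode) (encode s)

/-! ### The initial measure -/

/-- The Bernoulli measure on `{0, 1}^ℤ` with parameter `p ∈ [0, 1]`: the product over all sites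
of the measure giving mass `p` to `1` and `1 - p` to `0`. -/
def siteBernoulli (p : unitInterval) : Measure (ℤ → Bool) :=
  Measure.infinitePi fun _ : ℤ => bernoulliMeasure true false p

/-- The space `[-1, 1] × [0, 1]` of macroscopic states `m = (m 0, m 1)`. -/
def IsMacrostate (m : Fin 2 → ℝ) : Prop :=
  m 0 ∈ Set.Icc (-1 : ℝ) 1 ∧ m 1 ∈ Set.Icc (0 : ℝ) 1

theorem IsMacrostate.up_mem {m : Fin 2 → ℝ} (h : IsMacrostate m) :
    (1 + m 0) / 2 ∈ Set.Icc (0 : ℝ) 1 :=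
  ⟨by linarith [h.1.1], by linarith [h.1.2]⟩

/-- The product of the Bernoulli measures with parameters `(1 + m 0) / 2` and `m 1`. -/
def initialMeasure (m : Fin 2 → ℝ) (h : IsMacrostate m) : Measure State :=
  (siteBernoulli ⟨(1 + m 0) / 2, h.up_mem⟩).prod (siteBernoulli ⟨m 1, h.2⟩)

/-! ### Dynamics and macroscopic variables -/

/-- The Kac chain dynamics. For bits, `a + b - 2 * a * b` is the exclusive or. -/
def dyn (s : State) : State :=
  (fun i => xor (s.1 (i - 1)) (s.2 (i - 1)), s.2)

/-- The average magnetization and the fraction of scatterers over the `2 * N + 1` sites around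
the origin. -/
def macroVar (N : ℕ) (s : State) : Fin 2 → ℝ :=
  ![(1 / (2 * (N : ℝ) + 1)) * ∑ i ∈ Finset.Icc (-(N : ℤ)) N, (2 * ((s.1 i).toNat : ℝ) - 1),
    (1 / (2 * (N : ℝ) + 1)) * ∑ i ∈ Finset.Icc (-(N : ℤ)) N, ((s.2 i).toNat : ℝ)]

/-- The macroscopic law. -/
def macroLaw (m : Fin 2 → ℝ) : Fin 2 → ℝ :=
  ![(1 - 2 * m 1) * m 0, m 1]

end KacChain

end

/-
Along a random sequence, the deviation of a frequency from its mean is controlled by a Martin-Löf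
test that compares the number of ones among the first `k ^ 2` terms with a rational multiple of
`k ^ 2`. If the terms have finite-range correlations, Chebyshev's inequality bounds the measures by
`C / k ^ 2`, which is summable at a computable rate. So the frequencies converge along the squares,
and hence along all lengths, because the number of ones is monotone. For the Kac chain, the spin at
time `t` at a site is the initial spin `t` sites to the left times the signs of the `t` scatterers
in between, and the correlations of such products vanish for sites at distance more than `t`.
-/

namespace KacChain

section Probability

variable {Ω ι : Type*} [MeasurableSpace Ω] {μ : Measure Ω}

theorem covariance_le_of_variance_le [IsFiniteMeasure μ] {X Y : Ω → ℝ} (hX : MemLp X 2 μ)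
    (hY : MemLp Y 2 μ) {c : ℝ} (hXc : Var[X; μ] ≤ c) (hYc : Var[Y; μ] ≤ c) :
    cov[X, Y; μ] ≤ c := by
  have h := variance_nonneg (X - Y) μ
  rw [variance_sub hX hY] at h
  linarith

theorem variance_sum_le_of_card_le [IsFiniteMeasure μ] {X : ι → Ω → ℝ} {s : Finset ι}
    (hX : ∀ i ∈ s, MemLp (X i) 2 μ) {c : ℝ} (hc : ∀ i ∈ s, Var[X i; μ] ≤ c) {d : ℕ}
    (hd : ∀ i ∈ s, {j ∈ s | cov[X i, X j; μ] ≠ 0}.card ≤ d) :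
    Var[∑ i ∈ s, X i; μ] ≤ c * d * s.card := by
  have hrow (i) (hi : i ∈ s) : ∑ j ∈ s, cov[X i, X j; μ] ≤ c * d := by
    have hc0 : 0 ≤ c := (variance_nonneg _ _).trans (hc i hi)
    calc ∑ j ∈ s, cov[X i, X j; μ]
        = ∑ j ∈ s with cov[X i, X j; μ] ≠ 0, cov[X i, X j; μ] := (Finset.sum_filter_ne_zero s).symm
      _ ≤ {j ∈ s | cov[X i, X j; μ] ≠ 0}.card • c :=
          Finset.sum_le_card_nsmul _ _ _ fun j hj =>
            have hj := (Finset.mem_filter.1 hj).1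
            covariance_le_of_variance_le (hX i hi) (hX j hj) (hc i hi) (hc j hj)
      _ ≤ c * d := by
          rw [nsmul_eq_mul, mul_comm]
          exact mul_le_mul_of_nonneg_left (Nat.cast_le.2 (hd i hi)) hc0
  calc Var[∑ i ∈ s, X i; μ] = ∑ i ∈ s, ∑ j ∈ s, cov[X i, X j; μ] := variance_sum' hX
    _ ≤ s.card • (c * d) := Finset.sum_le_card_nsmul _ _ _ hrow
    _ = c * d * s.card := by rw [nsmul_eq_mul, mul_comm]

theorem measure_pos_le_variance_div_sq [IsFiniteMeasure μ] {Y : Ω → ℝ} (hY : MemLp Y 2 μ)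
    (hneg : μ[Y] < 0) : μ {ω | 0 < Y ω} ≤ ENNReal.ofReal (Var[Y; μ] / μ[Y] ^ 2) := by
  have h := meas_ge_le_variance_div_sq hY (neg_pos.2 hneg)
  rw [neg_sq] at h
  refine (measure_mono fun ω (hω : 0 < Y ω) => ?_).trans h
  have hle : -μ[Y] ≤ Y ω - μ[Y] := by linarith
  exact hle.trans (le_abs_self _)

theorem measure_linearForm_pos_le [IsProbabilityMeasure μ] {S : Ω → ℝ} (hS : MemLp S 2 μ)
    {M p C a b : ℝ} (hM : 0 < M) (hmean : μ[S] = p * M) (hvar : Var[S; μ] ≤ C * M)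
    (hab : a + b * p < 0) :
    μ {ω | 0 < a * M + b * S ω} ≤ ENNReal.ofReal (b ^ 2 * C / ((a + b * p) ^ 2 * M)) := by
  have hbS : MemLp (fun ω => b * S ω) 2 μ := hS.const_mul b
  have hY : MemLp (fun ω => a * M + b * S ω) 2 μ := (memLp_const (a * M)).add hbS
  have hYmean : ∫ ω, a * M + b * S ω ∂μ = (a + b * p) * M := by
    rw [integral_add (integrable_const (a * M)) (hbS.integrable one_le_two), integral_const,
      probReal_univ, one_smul, integral_const_mul, hmean]
    ring
  have hYvar : Var[fun ω => a * M + b * S ω; μ] ≤ b ^ 2 * (C * M) := by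
    rw [variance_const_add hbS.aestronglyMeasurable, variance_const_mul]
    exact mul_le_mul_of_nonneg_left hvar (sq_nonneg b)
  have hneg : ∫ ω, a * M + b * S ω ∂μ < 0 := by
    rw [hYmean]
    exact mul_neg_of_neg_of_pos hab hM
  have hchebyshev := measure_pos_le_variance_div_sq hY hneg
  rw [hYmean] at hchebyshev
  calc μ {ω | 0 < a * M + b * S ω}
      ≤ ENNReal.ofReal (Var[fun ω => a * M + b * S ω; μ] / ((a + b * p) * M) ^ 2) := hchebyshev
    _ ≤ ENNReal.ofReal (b ^ 2 * (C * M) / ((a + b * p) * M) ^ 2) := by gcongr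
    _ = ENNReal.ofReal (b ^ 2 * C / ((a + b * p) ^ 2 * M)) := by
        congr 1
        field_simp

theorem measure_iUnion_le_div_of_le_div_sq {E : ℕ → Set Ω} {C : ℝ} (hC : 0 ≤ C)
    (hE : ∀ k : ℕ, 0 < k → μ (E k) ≤ ENNReal.ofReal (C / (k : ℝ) ^ 2)) {K : ℕ} (hK : 0 < K) :
    μ (⋃ j, E (K + 1 + j)) ≤ ENNReal.ofReal (C / K) := by
  refine (measure_iUnion_le _).trans (ENNReal.tsum_le_of_sum_range_le fun J => ?_)
  have hsum : ∑ j ∈ Finset.range J, (((K + 1 + j : ℕ) : ℝ) ^ 2)⁻¹ ≤ (K : ℝ)⁻¹ := by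
    have h := sum_Ioc_inv_sq_le_sub (α := ℝ) hK.ne' (Nat.le_add_right K J)
    rw [← Finset.Ico_succ_succ_eq_Ioc, Finset.sum_Ico_eq_sum_range,
      Nat.succ_eq_succ, Nat.succ_sub_succ, Nat.add_sub_cancel_left] at h
    exact h.trans (sub_le_self _ (by positivity))
  calc ∑ j ∈ Finset.range J, μ (E (K + 1 + j))
      ≤ ∑ j ∈ Finset.range J, ENNReal.ofReal (C / ((K + 1 + j : ℕ) : ℝ) ^ 2) :=
        Finset.sum_le_sum fun j _ => hE _ (by omega)
    _ = ENNReal.ofReal (C * ∑ j ∈ Finset.range J, (((K + 1 + j : ℕ) : ℝ) ^ 2)⁻¹) := by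
        rw [← ENNReal.ofReal_sum_of_nonneg fun j _ => by positivity, Finset.mul_sum]
        rfl
    _ ≤ ENNReal.ofReal (C / K) := ENNReal.ofReal_le_ofReal (mul_le_mul_of_nonneg_left hsum hC)

theorem measurable_of_dependsOn {κ E : Type*} [Finite κ] [MeasurableSpace κ]
    [MeasurableSingletonClass κ] [MeasurableSpace E] [Nonempty E] {s : Set ι} (hs : s.Finite)
    {f : (ι → κ) → E} (hf : DependsOn f s) : Measurable f := by
  have := hs.to_subtype
  obtain ⟨g, rfl⟩ := dependsOn_iff_exists_comp.1 hf
  exact (measurable_of_finite g).comp (measurable_pi_lambda _ fun i => measurable_pi_apply i.1)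

theorem finite_range_of_dependsOn {κ E : Type*} [Finite κ] [Nonempty E] {s : Set ι} (hs : s.Finite)
    {f : (ι → κ) → E} (hf : DependsOn f s) : (Set.range f).Finite := by
  have := hs.to_subtype
  obtain ⟨g, rfl⟩ := dependsOn_iff_exists_comp.1 hf
  exact (Set.finite_range g).subset (Set.range_comp_subset_range _ g)

end Probability

section TruthTable

variable {α β γ δ : Type*} [Primcodable α] [Primcodable β] [Primcodable γ] [Primcodable δ]

/-- The infinite sequence that starts with `σ` and continues with `false`. -/
def extendFalse (σ : List Bool) (j : ℕ) : Bool := σ.getD j false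

theorem eqOn_extendFalse {σ : List Bool} {z : ℕ → Bool} (hz : z ∈ cylinder σ) :
    Set.EqOn z (extendFalse σ) (Set.Iio σ.length) := fun j hj => by
  rw [extendFalse, List.getD_eq_getElem _ _ hj]
  exact hz j hj

theorem mem_cylinder_ofFn (z : ℕ → Bool) (l : ℕ) :
    z ∈ cylinder (List.ofFn fun i : Fin l => z i) := fun i h => by simp

/-- `F z b` is computable from `b` and from a prefix of the oracle `z` whose length is bounded by a
computable function of `b` alone: `F` is a family of truth-table reductions, indexed by `β`. Such an
`F` is determined by the oracles that are eventually `false`, so computability is asked of these. -/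
structure IsTTComputable (F : (ℕ → Bool) → β → α) : Prop where
  exists_modulus : ∃ l : β → ℕ, Computable l ∧ ∀ b, DependsOn (fun z => F z b) (Set.Iio (l b))
  computable_extendFalse : Computable₂ fun σ b => F (extendFalse σ) b

theorem computable_sum_range {f : δ → ℕ → ℕ} (hf : Computable₂ f) :
    Computable₂ fun a M => ∑ n ∈ Finset.range M, f a n := by
  have hrec : Computable₂ fun (a : δ) (M : ℕ) => (M.rec 0 fun n c => c + f a n : ℕ) :=
    Computable.nat_rec Computable.snd (Computable.const 0) <|
      Primrec.nat_add.to_comp.comp (Computable.snd.comp Computable.snd)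
        (hf.comp (Computable.fst.comp Computable.fst) (Computable.fst.comp Computable.snd)) |>.to₂
  refine hrec.of_eq fun ⟨a, M⟩ => ?_
  induction M with
  | zero => rfl
  | succ n ih => exact congrArg (· + f a n) ih |>.trans (Finset.sum_range_succ _ _).symm

namespace IsTTComputable

theorem coord : IsTTComputable fun z (n : ℕ) => z n where
  exists_modulus := ⟨Nat.succ, Computable.succ, fun n _ _ h => h n n.lt_succ_self⟩
  computable_extendFalse := (Primrec.list_getD false).to_comp

theorem of_computable {f : β → α} (hf : Computable f) : IsTTComputable fun _ b => f b where
  exists_modulus := ⟨fun _ => 0, Computable.const 0, fun _ _ _ _ => rfl⟩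
  computable_extendFalse := hf.comp Computable.snd

theorem comp {F : (ℕ → Bool) → β → α} (hF : IsTTComputable F) {g : δ → β} (hg : Computable g) :
    IsTTComputable fun z d => F z (g d) where
  exists_modulus :=
    let ⟨l, hl, hFl⟩ := hF.exists_modulus
    ⟨fun d => l (g d), hl.comp hg, fun d => hFl (g d)⟩
  computable_extendFalse :=
    hF.computable_extendFalse.comp Computable.fst (hg.comp Computable.snd)

theorem map {f : α → δ} (hf : Computable f) {F : (ℕ → Bool) → β → α} (hF : IsTTComputable F) :
    IsTTComputable fun z b => f (F z b) where
  exists_modulus :=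
    let ⟨l, hl, hFl⟩ := hF.exists_modulus
    ⟨l, hl, fun b _ _ h => congrArg f (hFl b h)⟩
  computable_extendFalse := hf.comp hF.computable_extendFalse

theorem map₂ {f : α → γ → δ} (hf : Computable₂ f) {F : (ℕ → Bool) → β → α}
    (hF : IsTTComputable F) {G : (ℕ → Bool) → β → γ} (hG : IsTTComputable G) :
    IsTTComputable fun z b => f (F z b) (G z b) where
  exists_modulus := by
    obtain ⟨l, hl, hFl⟩ := hF.exists_modulus
    obtain ⟨l', hl', hGl'⟩ := hG.exists_modulus
    refine ⟨fun b => max (l b) (l' b), Primrec.nat_max.to_comp.comp hl hl', fun b z w h => ?_⟩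
    exact congrArg₂ f (hFl b fun i (hi : i < l b) => h i (lt_max_of_lt_left hi))
      (hGl' b fun i (hi : i < l' b) => h i (lt_max_of_lt_right hi))
  computable_extendFalse := hf.comp hF.computable_extendFalse hG.computable_extendFalse

theorem sum_range {F : (ℕ → Bool) → ℕ → ℕ} (hF : IsTTComputable F) :
    IsTTComputable fun z M => ∑ n ∈ Finset.range M, F z n where
  exists_modulus := by
    obtain ⟨l, hl, hFl⟩ := hF.exists_modulus
    refine ⟨fun M => ∑ n ∈ Finset.range M, l n,
      (computable_sum_range (hl.comp Computable.snd).to₂).comp (Computable.const ()) Computable.id,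
      fun M z w h => Finset.sum_congr rfl fun n hn => hFl n fun i hi => h i ?_⟩
    exact lt_of_lt_of_le hi (Finset.single_le_sum (fun _ _ => Nat.zero_le _) hn)
  computable_extendFalse := computable_sum_range hF.computable_extendFalse

end IsTTComputable

theorem uniformlyCE_exists {D : List Bool → ℕ × β → Bool} (hD : Computable₂ D) :
    UniformlyCE fun n => {σ | ∃ b, D σ (n, b) = true} := by
  let f (q : List Bool × ℕ) : Option (List Bool) :=
    (Encodable.decode q.1.length : Option (List Bool × β)).bind fun p =>
      bif D p.1 (q.2, p.2) then some p.1 else none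
  have hf : Computable f := by
    refine Computable.option_bind
      (Computable.decode.comp (Computable.list_length.comp Computable.fst)) ?_
    have hσ : Computable fun x : (List Bool × ℕ) × (List Bool × β) => x.2.1 :=
      Computable.fst.comp Computable.snd
    have hb : Computable fun x : (List Bool × ℕ) × (List Bool × β) => (x.1.2, x.2.2) :=
      (Computable.snd.comp Computable.fst).pair (Computable.snd.comp Computable.snd)
    exact Computable.cond (hD.comp hσ hb) (Computable.option_some.comp hσ) (Computable.const none)
  refine ⟨fun q => f q, Computable.ofOption hf, fun n => Set.ext fun σ => ⟨?_, ?_⟩⟩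
  · rintro ⟨b, hb⟩
    exact ⟨List.replicate (Encodable.encode (σ, b)) false, by simp [f, hb]⟩
  · rintro ⟨w, hw⟩
    obtain ⟨⟨τ, b⟩, -, hτ⟩ := Option.bind_eq_some_iff.1 (Part.mem_coe.1 hw)
    cases hD : D τ (n, b) <;> simp only [hD, cond_false, cond_true, reduceCtorEq,
      Option.some.injEq] at hτ
    exact ⟨b, hτ ▸ hD⟩

theorem IsTTComputable.uniformlyCEOpen_exists {F : (ℕ → Bool) → ℕ × β → Bool}
    (hF : IsTTComputable F) : UniformlyCEOpen fun n => {z | ∃ b, F z (n, b) = true} := by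
  obtain ⟨l, hl, hFl⟩ := hF.exists_modulus
  let D (σ : List Bool) (q : ℕ × β) : Bool := decide (l q ≤ σ.length) && F (extendFalse σ) q
  have hD : Computable₂ D := Primrec.and.to_comp.comp
    (Primrec.nat_le.decide.to_comp.comp (hl.comp Computable.snd)
      (Computable.list_length.comp Computable.fst)) hF.computable_extendFalse
  have hFσ {σ z q} (hz : z ∈ cylinder σ) (hq : l q ≤ σ.length) : F z q = F (extendFalse σ) q :=
    hFl q fun _ hi => eqOn_extendFalse hz (lt_of_lt_of_le hi hq)
  refine ⟨_, uniformlyCE_exists hD, fun n => Set.ext fun z => ?_⟩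
  simp only [Set.mem_iUnion, Set.mem_ofPred_eq, exists_prop, D, Bool.and_eq_true, decide_eq_true_eq]
  constructor
  · rintro ⟨b, hb⟩
    have hz := mem_cylinder_ofFn z (l (n, b))
    have hlen := (List.length_ofFn (f := fun i : Fin (l (n, b)) => z i)).ge
    exact ⟨_, ⟨b, hlen, hFσ hz hlen ▸ hb⟩, hz⟩
  · rintro ⟨σ, ⟨b, hlen, hb⟩, hz⟩
    exact ⟨b, (hFσ hz hlen).trans hb⟩

end TruthTable

section Random

theorem computable_two_pow : Computable fun n : ℕ => 2 ^ n := by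
  have h : Primrec fun n : ℕ => (n.rec 1 fun _ b => 2 * b : ℕ) :=
    Primrec.nat_rec₁ 1 (Primrec.nat_mul.comp (Primrec.const 2) Primrec.snd)
  refine h.to_comp.of_eq fun n => ?_
  induction n with
  | zero => rfl
  | succ n ih => exact (congrArg (2 * ·) ih).trans (pow_succ' 2 n).symm

theorem computable_linearForm_pos (a b : ℤ) :
    Computable₂ fun m n : ℕ => decide (0 < a * m + b * n) := by
  have hform : Primrec₂ fun m n : ℕ => decide ((-a).toNat * m + (-b).toNat * n <
      a.toNat * m + b.toNat * n) := by
    have hlin (c d : ℕ) : Primrec fun q : ℕ × ℕ => c * q.1 + d * q.2 :=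
      Primrec.nat_add.comp (Primrec.nat_mul.comp (Primrec.const c) Primrec.fst)
        (Primrec.nat_mul.comp (Primrec.const d) Primrec.snd)
    exact (Primrec.nat_lt.comp (hlin _ _) (hlin _ _)).decide
  refine hform.to_comp.of_eq fun ⟨m, n⟩ => decide_eq_decide.2 ?_
  have h : a * m + b * n =
      ((a.toNat * m + b.toNat * n : ℕ) : ℤ) - ((-a).toNat * m + (-b).toNat * n : ℕ) := by
    push_cast
    linear_combination -(m : ℤ) * a.toNat_sub_toNat_neg - (n : ℤ) * b.toNat_sub_toNat_neg
  rw [h, sub_pos, Nat.cast_lt]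

variable {ν : Measure (ℕ → Bool)} {z : ℕ → Bool}

theorem IsTTComputable.measurable {α β : Type*} [Primcodable α] [Primcodable β]
    [MeasurableSpace α] {F : (ℕ → Bool) → β → α} (hF : IsTTComputable F) (b : β) :
    Measurable fun w => F w b :=
  let ⟨l, _, hl⟩ := hF.exists_modulus
  have : Nonempty α := ⟨F default b⟩
  measurable_of_dependsOn (Set.finite_Iio (l b)) (hl b)

theorem IsTTComputable.memLp_natCast {β : Type*} [Primcodable β] {S : (ℕ → Bool) → β → ℕ}
    (hS : IsTTComputable S) (b : β) (p : ℝ≥0∞) [IsFiniteMeasure ν] :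
    MemLp (fun w => (S w b : ℝ)) p ν := by
  obtain ⟨l, _, hl⟩ := hS.exists_modulus
  obtain ⟨C, hC⟩ := (finite_range_of_dependsOn (Set.finite_Iio (l b)) (hl b)).bddAbove
  refine .of_bound (measurable_from_nat.comp (hS.measurable b)).aestronglyMeasurable C
    (.of_forall fun w => ?_)
  rw [Real.norm_natCast, Nat.cast_le]
  exact hC ⟨w, rfl⟩

theorem IsMLRandom.eventually_eq_false (hz : IsMLRandom ν z) {F : (ℕ → Bool) → ℕ → Bool}
    (hF : IsTTComputable F) {g : ℕ → ℕ} (hg : Computable g)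
    (h : ∀ n, ν {w | ∃ j, F w (g n + j) = true} ≤ (2 : ℝ≥0∞)⁻¹ ^ n) :
    ∀ᶠ k in atTop, F z k = false := by
  have hgj : Computable fun q : ℕ × ℕ => g q.1 + q.2 :=
    Primrec.nat_add.to_comp.comp (hg.comp Computable.fst) Computable.snd
  have htest : IsMLTest ν fun n => {w | ∃ j, F w (g n + j) = true} :=
    ⟨(hF.comp hgj).uniformlyCEOpen_exists, h⟩
  obtain ⟨n, hn⟩ : ∃ n, ¬ ∃ j, F z (g n + j) = true := by
    by_contra! hall
    exact hz ⟨_, htest, Set.singleton_subset_iff.2 (Set.mem_iInter.2 hall)⟩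
  refine eventually_atTop.2 ⟨g n, fun k hk => ?_⟩
  obtain ⟨j, rfl⟩ := Nat.exists_eq_add_of_le hk
  exact Bool.eq_false_iff.2 fun hj => hn ⟨j, hj⟩

theorem IsMLRandom.eventually_eq_false_of_le_div_sq (hz : IsMLRandom ν z)
    {F : (ℕ → Bool) → ℕ → Bool} (hF : IsTTComputable F) {C : ℝ} (hC : 0 ≤ C)
    (h : ∀ k : ℕ, 0 < k → ν {w | F w k = true} ≤ ENNReal.ofReal (C / (k : ℝ) ^ 2)) :
    ∀ᶠ k in atTop, F z k = false := by
  obtain ⟨c, hCc⟩ := exists_nat_gt C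
  have hc : (0 : ℝ) < c := hC.trans_lt hCc
  have hg : Computable fun n => c * 2 ^ n + 1 :=
    Computable.succ.comp (Primrec.nat_mul.to_comp.comp (Computable.const c) computable_two_pow)
  refine hz.eventually_eq_false hF hg fun n => ?_
  have hK : 0 < c * 2 ^ n := Nat.mul_pos (Nat.cast_pos.1 hc) (by positivity)
  calc ν {w | ∃ j, F w (c * 2 ^ n + 1 + j) = true}
      = ν (⋃ j, {w | F w (c * 2 ^ n + 1 + j) = true}) := by rw [Set.ofPred_exists]
    _ ≤ ENNReal.ofReal (C / (c * 2 ^ n : ℕ)) :=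
        measure_iUnion_le_div_of_le_div_sq (E := fun k => {w | F w k = true}) hC h hK
    _ ≤ ENNReal.ofReal ((2 ^ n)⁻¹) := by
        refine ENNReal.ofReal_le_ofReal ?_
        rw [Nat.cast_mul, Nat.cast_pow, Nat.cast_ofNat, ← div_div, div_eq_mul_inv _ (2 ^ n : ℝ)]
        exact mul_le_of_le_one_left (by positivity) ((div_le_one hc).2 hCc.le)
    _ = (2 : ℝ≥0∞)⁻¹ ^ n := by
        rw [ENNReal.ofReal_inv_of_pos (by positivity), ENNReal.ofReal_pow zero_le_two,
          ENNReal.ofReal_ofNat, ENNReal.inv_pow]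

theorem IsMLRandom.eventually_linearForm_le_zero [IsProbabilityMeasure ν] (hz : IsMLRandom ν z)
    {S : (ℕ → Bool) → ℕ → ℕ} (hS : IsTTComputable S) {p C : ℝ}
    (hmean : ∀ M : ℕ, ∫ w, (S w M : ℝ) ∂ν = p * M)
    (hvar : ∀ M : ℕ, Var[fun w => (S w M : ℝ); ν] ≤ C * M) {a b : ℤ} (hab : a + b * p < 0) :
    ∀ᶠ k : ℕ in atTop, (a * (k * k : ℕ) + b * S z (k * k) : ℝ) ≤ 0 := by
  let F (w : ℕ → Bool) (k : ℕ) : Bool := decide (0 < a * (k * k : ℕ) + b * S w (k * k))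
  have hsq : Computable fun k : ℕ => k * k := (Primrec.nat_mul.comp Primrec.id Primrec.id).to_comp
  have hF : IsTTComputable F := (IsTTComputable.of_computable hsq).map₂
    (computable_linearForm_pos a b) (hS.comp hsq)
  have hC : 0 ≤ C := by simpa using (variance_nonneg _ _).trans (hvar 1)
  have hchebyshev (k : ℕ) (hk : 0 < k) : ν {w | F w k = true} ≤
      ENNReal.ofReal (b ^ 2 * C / (a + b * p) ^ 2 / (k : ℝ) ^ 2) := by
    have hkk : (0 : ℝ) < (k * k : ℕ) := Nat.cast_pos.2 (Nat.mul_pos hk hk)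
    calc ν {w | F w k = true} = ν {w | (0 : ℝ) < a * (k * k : ℕ) + b * S w (k * k)} := by
          congr 1 with w
          exact decide_eq_true_iff.trans (by exact_mod_cast Iff.rfl)
      _ ≤ ENNReal.ofReal (b ^ 2 * C / ((a + b * p) ^ 2 * (k * k : ℕ))) :=
          measure_linearForm_pos_le (hS.memLp_natCast _ _) hkk (hmean _) (hvar _) hab
      _ = ENNReal.ofReal (b ^ 2 * C / (a + b * p) ^ 2 / (k : ℝ) ^ 2) := by
          rw [Nat.cast_mul, ← sq, div_div]
  filter_upwards [hz.eventually_eq_false_of_le_div_sq hF (by positivity) hchebyshev] with k hk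
  exact_mod_cast not_lt.1 (decide_eq_false_iff_not.1 hk)

theorem eventually_succ_sq_le_mul_sq {a : ℝ} (ha : 1 < a) :
    ∀ᶠ k : ℕ in atTop, (((k + 1) * (k + 1) : ℕ) : ℝ) ≤ a * (k * k : ℕ) := by
  have hlim : Tendsto (fun k : ℕ => (1 + 1 / (k : ℝ)) ^ 2) atTop (𝓝 1) := by
    simpa using ((tendsto_one_div_atTop_nhds_zero_nat (𝕜 := ℝ)).const_add 1).pow 2
  filter_upwards [hlim.eventually_le_const ha, eventually_gt_atTop 0] with k hk hk0
  have : (0 : ℝ) < k := Nat.cast_pos.2 hk0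
  push_cast
  calc ((k : ℝ) + 1) * (k + 1) = (1 + 1 / (k : ℝ)) ^ 2 * (k * k) := by field_simp
    _ ≤ a * (k * k) := by gcongr

theorem IsMLRandom.tendsto_sq_div [IsProbabilityMeasure ν] (hz : IsMLRandom ν z)
    {S : (ℕ → Bool) → ℕ → ℕ} (hS : IsTTComputable S) {p C : ℝ}
    (hmean : ∀ M : ℕ, ∫ w, (S w M : ℝ) ∂ν = p * M)
    (hvar : ∀ M : ℕ, Var[fun w => (S w M : ℝ); ν] ≤ C * M) :
    Tendsto (fun k : ℕ => (S z (k * k) : ℝ) / (k * k : ℕ)) atTop (𝓝 p) := by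
  have hle {a b : ℤ} (hab : a + b * p < 0) :
      ∀ᶠ k : ℕ in atTop, a + b * ((S z (k * k) : ℝ) / (k * k : ℕ)) ≤ 0 := by
    filter_upwards [hz.eventually_linearForm_le_zero hS hmean hvar hab, eventually_gt_atTop 0]
      with k hk hk0
    have hkk : (0 : ℝ) < (k * k : ℕ) := Nat.cast_pos.2 (Nat.mul_pos hk0 hk0)
    have := div_nonpos_of_nonpos_of_nonneg hk hkk.le
    rwa [add_div, mul_div_cancel_right₀ _ hkk.ne', mul_div_assoc] at this
  have hden (q : ℚ) : (0 : ℝ) < q.den := Nat.cast_pos.2 q.den_pos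
  have hnum (q : ℚ) : (q.num : ℝ) = q.den * q := mod_cast q.den_mul_eq_num.symm
  refine tendsto_order.2 ⟨fun x hx => ?_, fun x hx => ?_⟩
  · obtain ⟨q, hxq, hqp⟩ := exists_rat_btwn hx
    have hlt := mul_lt_mul_of_pos_left hqp (hden q)
    filter_upwards [hle (a := q.num) (b := -q.den) (by push_cast; linarith [hnum q])] with k hk
    push_cast [hnum] at hk
    exact hxq.trans_le (le_of_mul_le_mul_left (by push_cast; linarith) (hden q))
  · obtain ⟨q, hpq, hqx⟩ := exists_rat_btwn hx
    have hlt := mul_lt_mul_of_pos_left hpq (hden q)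
    filter_upwards [hle (a := -q.num) (b := q.den) (by push_cast; linarith [hnum q])] with k hk
    push_cast [hnum] at hk
    exact lt_of_le_of_lt (le_of_mul_le_mul_left (by push_cast; linarith) (hden q)) hqx

theorem IsMLRandom.tendsto_div [IsProbabilityMeasure ν] (hz : IsMLRandom ν z)
    {S : (ℕ → Bool) → ℕ → ℕ} (hS : IsTTComputable S) (hmono : Monotone (S z)) {p C : ℝ}
    (hmean : ∀ M : ℕ, ∫ w, (S w M : ℝ) ∂ν = p * M)
    (hvar : ∀ M : ℕ, Var[fun w => (S w M : ℝ); ν] ≤ C * M) :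
    Tendsto (fun M : ℕ => (S z M : ℝ) / M) atTop (𝓝 p) :=
  tendsto_div_of_monotone_of_exists_subseq_tendsto_div _ p (Nat.mono_cast.comp hmono)
    fun _ ha => ⟨fun k => k * k, eventually_succ_sq_le_mul_sq ha,
      tendsto_id.atTop_mul_atTop₀ tendsto_id, hz.tendsto_sq_div hS hmean hvar⟩

end Random

section Spin

/-- The spin `1` or `-1` of a bit. -/
def spin (b : Bool) : ℝ := 2 * (b.toNat : ℝ) - 1

theorem abs_spin (b : Bool) : |spin b| = 1 := by
  cases b <;> norm_num [spin]

variable {ι Ω : Type*}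

theorem cast_sum_toNat (s : Finset ι) (b : ι → Bool) :
    ((∑ i ∈ s, (b i).toNat : ℕ) : ℝ) = 2⁻¹ * ∑ i ∈ s, spin (b i) + s.card / 2 := by
  simp only [spin, Finset.sum_sub_distrib, ← Finset.mul_sum, Finset.sum_const, nsmul_eq_mul]
  push_cast
  ring

variable [MeasurableSpace Ω] {μ : Measure Ω}

theorem memLp_spin [IsFiniteMeasure μ] {f : Ω → Bool} (hf : Measurable f) (p : ℝ≥0∞) :
    MemLp (fun ω => spin (f ω)) p μ :=
  .of_bound ((measurable_of_finite spin).comp hf).aestronglyMeasurable 1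
    (.of_forall fun ω => (abs_spin (f ω)).le)

theorem variance_spin_le_one [IsProbabilityMeasure μ] {f : Ω → Bool} (hf : Measurable f) :
    Var[fun ω => spin (f ω); μ] ≤ 1 := by
  have h := variance_le_sq_of_bounded (a := -1) (b := 1)
    (.of_forall fun ω => abs_le.1 (abs_spin (f ω)).le)
    (memLp_spin (μ := μ) hf 2).aemeasurable
  norm_num at h
  exact h

variable [IsProbabilityMeasure μ] {s : Finset ι} {f : ι → Ω → Bool}

theorem integral_sum_toNat (hf : ∀ i, Measurable (f i)) {v : ℝ}
    (hmean : ∀ i ∈ s, ∫ ω, spin (f i ω) ∂μ = v) :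
    ∫ ω, ((∑ i ∈ s, (f i ω).toNat : ℕ) : ℝ) ∂μ = (1 + v) / 2 * s.card := by
  have hint (i) : Integrable (fun ω => spin (f i ω)) μ := (memLp_spin (hf i) 1).integrable le_rfl
  simp only [cast_sum_toNat]
  rw [integral_add ((integrable_finsetSum s fun i _ => hint i).const_mul _) (integrable_const _),
    integral_const_mul, integral_finsetSum _ fun i _ => hint i, Finset.sum_congr rfl hmean]
  simp only [Finset.sum_const, nsmul_eq_mul, integral_const, probReal_univ, one_smul]
  ring

theorem variance_sum_toNat_le (hf : ∀ i, Measurable (f i)) {d : ℕ}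
    (hcov : ∀ i ∈ s, {j ∈ s | cov[fun ω => spin (f i ω), fun ω => spin (f j ω); μ] ≠ 0}.card ≤ d) :
    Var[fun ω => ((∑ i ∈ s, (f i ω).toNat : ℕ) : ℝ); μ] ≤ d / 4 * s.card := by
  have hmem (i) : MemLp (fun ω => spin (f i ω)) 2 μ := memLp_spin (hf i) 2
  have h := variance_sum_le_of_card_le (fun i _ => hmem i)
    (fun i _ => variance_spin_le_one (hf i)) hcov
  have hsum := (memLp_finsetSum s fun i _ => hmem i).const_mul 2⁻¹
  simp only [cast_sum_toNat]
  rw [variance_add_const hsum.aestronglyMeasurable, variance_const_mul]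
  simp only [one_mul, Finset.sum_fn] at h
  linarith

theorem IsMLRandom.tendsto_average_spin {ν : Measure (ℕ → Bool)} [IsProbabilityMeasure ν]
    {z : ℕ → Bool} (hz : IsMLRandom ν z) {F : (ℕ → Bool) → ℕ → Bool} (hF : IsTTComputable F)
    {v : ℝ} (hmean : ∀ n, ∫ w, spin (F w n) ∂ν = v) {d : ℕ}
    (hcov : ∀ M, ∀ n ∈ Finset.range M, {k ∈ Finset.range M |
      cov[fun w => spin (F w n), fun w => spin (F w k); ν] ≠ 0}.card ≤ d) :
    Tendsto (fun M : ℕ => (∑ n ∈ Finset.range M, spin (F z n)) / M) atTop (𝓝 v) := by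
  let S (w : ℕ → Bool) (M : ℕ) : ℕ := ∑ n ∈ Finset.range M, (F w n).toNat
  have hS : IsTTComputable S := (hF.map (Primrec.dom_bool Bool.toNat).to_comp).sum_range
  have hmono : Monotone (S z) := fun _ _ h =>
    Finset.sum_le_sum_of_subset (Finset.range_mono h)
  have hS_mean (M : ℕ) : ∫ w, (S w M : ℝ) ∂ν = (1 + v) / 2 * M := by
    simpa only [Finset.card_range] using
      integral_sum_toNat (s := .range M) hF.measurable fun n _ => hmean n
  have hS_var (M : ℕ) : Var[fun w => (S w M : ℝ); ν] ≤ d / 4 * M := by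
    simpa only [Finset.card_range] using variance_sum_toNat_le hF.measurable (hcov M)
  have hlim := ((hz.tendsto_div hS hmono hS_mean hS_var).const_mul 2).sub_const 1
  rw [show 2 * ((1 + v) / 2) - 1 = v by ring] at hlim
  refine hlim.congr' ?_
  filter_upwards [eventually_gt_atTop 0] with M hM
  have : (0 : ℝ) < M := Nat.cast_pos.2 hM
  rw [cast_sum_toNat, Finset.card_range]
  field_simp
  ring

end Spin

section Field

theorem site_injective : Function.Injective site := by
  intro a b h
  simp only [site] at h
  split_ifs at h <;> omega

theorem map_site_range (N : ℕ) :
    (Finset.range (2 * N + 1)).map ⟨site, site_injective⟩ = Finset.Icc (-(N : ℤ)) N := by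
  refine Finset.eq_of_subset_of_card_le (fun i hi => ?_) ?_
  · obtain ⟨n, hn, rfl⟩ := Finset.mem_map.1 hi
    have := Finset.mem_range.1 hn
    simp only [Function.Embedding.coeFn_mk, Finset.mem_Icc, site]
    split_ifs <;> omega
  · rw [Finset.card_map, Finset.card_range, Int.card_Icc]
    omega

theorem encode_two_mul (s : State) (n : ℕ) : encode s (2 * n) = s.1 (site n) := by
  simp [encode, kappa, iota]

theorem encode_two_mul_add_one (s : State) (n : ℕ) : encode s (2 * n + 1) = s.2 (site n) := by
  rw [encode, kappa, if_neg (by omega), iota, show (2 * n + 1) / 2 = n by omega]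

/-- The index of the site to the left of the site with index `n`. -/
def predIndex (n : ℕ) : ℕ := if n % 2 = 1 then n + 2 else if n = 0 then 1 else n - 2

theorem site_predIndex (n : ℕ) : site (predIndex n) = site n - 1 := by
  unfold predIndex
  split_ifs <;> simp only [site] <;> split_ifs <;> first | contradiction | omega

theorem primrec_predIndex : Primrec predIndex :=
  Primrec.ite (Primrec.eq.comp (Primrec.nat_mod.comp Primrec.id (Primrec.const 2))
    (Primrec.const 1)) (Primrec.nat_add.comp Primrec.id (Primrec.const 2))
    (Primrec.ite (Primrec.eq.comp Primrec.id (Primrec.const 0)) (Primrec.const 1)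
      (Primrec.nat_sub.comp Primrec.id (Primrec.const 2)))

/-- A field of bits on the chain that is a function of the microstate and can be computed from its
code, uniformly in the site, by a truth-table reduction. -/
def IsComputableField (f : State → ℤ → Bool) : Prop :=
  ∃ F : (ℕ → Bool) → ℕ → Bool, IsTTComputable F ∧ ∀ s n, F (encode s) n = f s (site n)

namespace IsComputableField

variable {f g : State → ℤ → Bool}

theorem fst : IsComputableField fun s => s.1 :=
  ⟨_, IsTTComputable.coord.comp (Primrec.nat_mul.comp (Primrec.const 2) Primrec.id).to_comp,
    encode_two_mul⟩

theorem snd : IsComputableField fun s => s.2 :=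
  ⟨_, IsTTComputable.coord.comp
    (Primrec.succ.comp (Primrec.nat_mul.comp (Primrec.const 2) Primrec.id)).to_comp,
    encode_two_mul_add_one⟩

theorem shift (hf : IsComputableField f) : IsComputableField fun s i => f s (i - 1) :=
  let ⟨_, hF, hFf⟩ := hf
  ⟨_, hF.comp primrec_predIndex.to_comp, fun s n => by rw [hFf, site_predIndex]⟩

theorem xor (hf : IsComputableField f) (hg : IsComputableField g) :
    IsComputableField fun s i => Bool.xor (f s i) (g s i) :=
  let ⟨_, hF, hFf⟩ := hf
  let ⟨_, hG, hGg⟩ := hg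
  ⟨_, hF.map₂ (Primrec.dom_bool₂ Bool.xor).to_comp hG,
    fun s n => congrArg₂ Bool.xor (hFf s n) (hGg s n)⟩

end IsComputableField

theorem IsMLRandomState.tendsto_average_spin {μ : Measure State} [IsProbabilityMeasure μ]
    {s : State} (hs : IsMLRandomState μ s) {f : State → ℤ → Bool} (hf : IsComputableField f)
    {v : ℝ} (hmean : ∀ i, ∫ s, spin (f s i) ∂μ = v) {R : ℕ} (hcov : ∀ i j : ℤ, R < |i - j| →
      cov[fun s => spin (f s i), fun s => spin (f s j); μ] = 0) :
    Tendsto (fun N : ℕ => (1 / (2 * (N : ℝ) + 1)) * ∑ i ∈ Finset.Icc (-(N : ℤ)) N, spin (f s i))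
      atTop (𝓝 v) := by
  obtain ⟨F, hF, hFf⟩ := hf
  have : IsProbabilityMeasure (μ.map encode) :=
    Measure.isProbabilityMeasure_map measurable_encode.aemeasurable
  have hmeas (n) : AEStronglyMeasurable (fun w => spin (F w n)) (μ.map encode) :=
    (memLp_spin (hF.measurable n) 1).aestronglyMeasurable
  have hmean' (n : ℕ) : ∫ w, spin (F w n) ∂μ.map encode = v := by
    rw [integral_map measurable_encode.aemeasurable (hmeas n)]
    simp only [hFf, hmean]
  have hcov' (n k : ℕ) : cov[fun w => spin (F w n), fun w => spin (F w k); μ.map encode] =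
      cov[fun s => spin (f s (site n)), fun s => spin (f s (site k)); μ] := by
    rw [covariance_map_fun (hmeas n) (hmeas k) measurable_encode.aemeasurable]
    simp only [hFf]
  have hcard (M n : ℕ) : {k ∈ Finset.range M | cov[fun w => spin (F w n), fun w => spin (F w k);
      μ.map encode] ≠ 0}.card ≤ 2 * R + 1 := by
    calc _ ≤ (Finset.Icc (site n - R) (site n + R)).card :=
          Finset.card_le_card_of_injOn site (fun k hk => ?_) site_injective.injOn
      _ = 2 * R + 1 := by
          rw [Int.card_Icc]
          omega
    have hk := mt (hcov (site n) (site k)) (hcov' n k ▸ (Finset.mem_filter.1 hk).2)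
    rw [not_lt, abs_le] at hk
    exact Finset.mem_coe.2 (Finset.mem_Icc.2 (by omega))
  have hlim := (IsMLRandom.tendsto_average_spin hs hF hmean' fun M n _ => hcard M n).comp
    (tendsto_atTop_mono (fun N => (by omega : N ≤ 2 * N + 1)) tendsto_id)
  refine hlim.congr fun N => ?_
  rw [← map_site_range, Finset.sum_map, one_div_mul_eq_div]
  simp only [Function.comp_apply, Function.Embedding.coeFn_mk, hFf]
  push_cast
  rfl

end Field

section Kac

variable {m : Fin 2 → ℝ} {hm : IsMacrostate m}

instance (p : unitInterval) : IsProbabilityMeasure (siteBernoulli p) :=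
  inferInstanceAs (IsProbabilityMeasure (Measure.infinitePi _))

instance : IsProbabilityMeasure (initialMeasure m hm) :=
  inferInstanceAs (IsProbabilityMeasure (Measure.prod _ _))

theorem integral_prod_siteBernoulli (p : unitInterval) (A : Finset ℤ) (f : Bool → ℝ) :
    ∫ x, ∏ a ∈ A, f (x a) ∂siteBernoulli p
      = (∫ b, f b ∂(bernoulliMeasure true false p)) ^ A.card := by
  have hprod (x : ℤ → Bool) : ∏ a ∈ A, f (x a) = ∏ a : A, f (A.restrict x a) :=
    (Finset.prod_coe_sort A fun a => f (x a)).symm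
  simp only [hprod]
  rw [siteBernoulli, integral_restrict_infinitePi (μ := fun _ : ℤ => bernoulliMeasure true false p)
    (f := fun v : A → Bool => ∏ a, f (v a)) (measurable_of_finite _).aestronglyMeasurable,
    integral_fintype_prod_eq_pow, Fintype.card_coe]

/-- The product of the spins at the sites of `A` and of the opposite scatterer signs at the sites
of `B`. -/
def character (A B : Finset ℤ) (s : State) : ℝ :=
  (∏ a ∈ A, spin (s.1 a)) * ∏ b ∈ B, -spin (s.2 b)

theorem abs_character (A B : Finset ℤ) (s : State) : |character A B s| = 1 := by
  simp [character, abs_mul, Finset.abs_prod, abs_spin]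

theorem measurable_character (A B : Finset ℤ) : Measurable (character A B) := by
  have h : Measurable spin := measurable_of_finite _
  unfold character
  fun_prop

theorem character_mul_of_disjoint {A B A' B' : Finset ℤ} (hA : Disjoint A A')
    (hB : Disjoint B B') : character A B * character A' B' = character (A ∪ A') (B ∪ B') := by
  funext s
  simp only [character, Pi.mul_apply, Finset.prod_union hA, Finset.prod_union hB]
  ring

theorem integral_character (A B : Finset ℤ) :
    ∫ s, character A B s ∂initialMeasure m hm = m 0 ^ A.card * (1 - 2 * m 1) ^ B.card := by
  unfold character initialMeasure
  rw [integral_prod_mul (f := fun x : ℤ → Bool => ∏ a ∈ A, spin (x a))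
    (g := fun y : ℤ → Bool => ∏ b ∈ B, -spin (y b)), integral_prod_siteBernoulli,
    integral_prod_siteBernoulli (f := fun b => -spin b)]
  congr 2 <;>
  · simp [integral_bernoulliMeasure, spin]
    ring

theorem covariance_character_of_disjoint {A B A' B' : Finset ℤ} (hA : Disjoint A A')
    (hB : Disjoint B B') : cov[character A B, character A' B'; initialMeasure m hm] = 0 := by
  have hmem (A B) : MemLp (character A B) 2 (initialMeasure m hm) :=
    .of_bound (measurable_character A B).aestronglyMeasurable 1
      (.of_forall fun s => (abs_character A B s).le)
  rw [covariance_eq_sub (hmem A B) (hmem A' B'), character_mul_of_disjoint hA hB]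
  simp only [integral_character, Finset.card_union_of_disjoint hA,
    Finset.card_union_of_disjoint hB]
  ring

theorem dyn_iterate_snd (s : State) (t : ℕ) : (dyn^[t] s).2 = s.2 := by
  induction t with
  | zero => rfl
  | succ t ih => rw [Function.iterate_succ_apply', dyn, ih]

theorem dyn_iterate_succ_fst (s : State) (t : ℕ) (i : ℤ) :
    (dyn^[t + 1] s).1 i = xor ((dyn^[t] s).1 (i - 1)) (s.2 (i - 1)) := by
  rw [Function.iterate_succ_apply', dyn, dyn_iterate_snd]

theorem isComputableField_dyn_iterate_fst (t : ℕ) :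
    IsComputableField fun s => (dyn^[t] s).1 := by
  induction t with
  | zero => exact .fst
  | succ t ih =>
    convert (ih.xor .snd).shift using 3 with s i
    exact dyn_iterate_succ_fst s t i

theorem spin_xor (a b : Bool) : spin (xor a b) = spin a * -spin b := by
  cases a <;> cases b <;> norm_num [spin]

theorem spin_dyn_iterate_fst (s : State) (t : ℕ) (i : ℤ) :
    spin ((dyn^[t] s).1 i) = character {i - t} (Finset.Ico (i - t) i) s := by
  induction t generalizing i with
  | zero => simp [character]
  | succ t ih =>
    have hsub : i - ((t + 1 : ℕ) : ℤ) = i - 1 - t := by push_cast; ring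
    have hIco : Finset.Ico (i - 1 - t) i = insert (i - 1) (Finset.Ico (i - 1 - t) (i - 1)) := by
      ext j
      simp only [Finset.mem_Ico, Finset.mem_insert]
      omega
    rw [dyn_iterate_succ_fst, spin_xor, ih, hsub, hIco, character, character,
      Finset.prod_insert (by simp)]
    ring

theorem macroLaw_iterate (m : Fin 2 → ℝ) (t : ℕ) :
    macroLaw^[t] m = ![(1 - 2 * m 1) ^ t * m 0, m 1] := by
  induction t with
  | zero =>
    ext i
    fin_cases i <;> simp
  | succ t ih =>
    rw [Function.iterate_succ_apply', ih, macroLaw]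
    ext i
    fin_cases i <;> simp [pow_succ']
    ring

theorem tendsto_magnetization {s : State} (hs : IsMLRandomState (initialMeasure m hm) s) (t : ℕ) :
    Tendsto (fun N : ℕ => macroVar N (dyn^[t] s) 0) atTop (𝓝 ((1 - 2 * m 1) ^ t * m 0)) := by
  refine hs.tendsto_average_spin (isComputableField_dyn_iterate_fst t) (R := t) (fun i => ?_)
    fun i j hij => ?_
  · simp [spin_dyn_iterate_fst, integral_character, mul_comm]
  · simp only [spin_dyn_iterate_fst]
    rw [lt_abs] at hij
    refine covariance_character_of_disjoint ?_ ?_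
    · rw [Finset.disjoint_singleton]
      omega
    · simp only [Finset.disjoint_left, Finset.mem_Ico]
      omega

theorem macroVar_one (N : ℕ) (s : State) :
    macroVar N s 1
      = (1 + (1 / (2 * (N : ℝ) + 1)) * ∑ i ∈ Finset.Icc (-(N : ℤ)) N, spin (s.2 i)) / 2 := by
  have hsum := cast_sum_toNat (Finset.Icc (-(N : ℤ)) N) s.2
  have hcard : ((Finset.Icc (-(N : ℤ)) N).card : ℝ) = 2 * N + 1 := by
    rw [← map_site_range, Finset.card_map, Finset.card_range]
    push_cast
    rfl
  rw [hcard] at hsum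
  push_cast at hsum
  have : (0 : ℝ) < 2 * N + 1 := by positivity
  simp only [macroVar, Matrix.cons_val_one, Matrix.cons_val_fin_one, hsum]
  field_simp
  ring

theorem tendsto_scatterers {s : State} (hs : IsMLRandomState (initialMeasure m hm) s) (t : ℕ) :
    Tendsto (fun N : ℕ => macroVar N (dyn^[t] s) 1) atTop (𝓝 (m 1)) := by
  have hspin (s : State) (i : ℤ) : spin (s.2 i) = -character ∅ {i} s := by simp [character]
  have hlim := hs.tendsto_average_spin .snd (v := -(1 - 2 * m 1)) (R := 0)
    (fun i => by simp [hspin, integral_neg, integral_character]) fun i j hij => by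
      have hne : i ≠ j := fun h => by simp [h] at hij
      simp only [hspin, covariance_fun_neg_left, covariance_fun_neg_right, neg_neg]
      exact covariance_character_of_disjoint (Finset.disjoint_empty_left _)
        (Finset.disjoint_singleton.2 hne)
  simp only [macroVar_one, dyn_iterate_snd]
  rw [show m 1 = (1 + -(1 - 2 * m 1)) / 2 by ring]
  exact (hlim.const_add 1).div_const 2

end Kac

end KacChain

theorem theorem3_general (m : Fin 2 → ℝ) (hm : KacChain.IsMacrostate m) (s : KacChain.State)
    (hs : KacChain.IsMLRandomState (KacChain.initialMeasure m hm) s) (i : Fin 2) (t : ℕ) :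
    Tendsto (fun N : ℕ => KacChain.macroVar N (KacChain.dyn^[t] s) i) atTop
      (𝓝 (KacChain.macroLaw^[t] m i)) := by
  rw [KacChain.macroLaw_iterate]
  fin_cases i
  · exact KacChain.tendsto_magnetization hs t
  · exact KacChain.tendsto_scatterers hs t

theorem theorem3 (m : Fin 2 → ℝ) (hm : KacChain.IsMacrostate m)
    (hcomp : ∀ i, KacChain.IsComputableReal (m i)) (T : ℕ) (s : KacChain.State)
    (hs : KacChain.IsMLRandomState (KacChain.initialMeasure m hm) s) :
    ∀ i : Fin 2, ∀ t : ℕ, t ≤ T →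
      Tendsto (fun N : ℕ => KacChain.macroVar N (KacChain.dyn^[t] s) i) atTop
        (𝓝 (KacChain.macroLaw^[t] m i)) :=
  fun i t _ => theorem3_general m hm s hs i t
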